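/- Let $(R,\varsigma)$ be a transformal domain (an integral domain with an injective endomorphism) and $S=\operatorname{Spec}R$. A variety is a reduced separated scheme of finite presentation over $S$. An almost direct presentation $(X,\Sigma)$ over $(R,\varsigma)$ consists of varieties $X_0,X_1$, an $S$-morphism $\pi:X_1\to X_0$, and a family of morphisms $\sigma:X_1\to X_0$, indexed by $\sigma\in\Sigma$, lying over $\operatorname{Spec}\varsigma:S\to S$. A morphism $f:(X,\Sigma)\to(Y,T)$ consists of a map $\sigma\mapsto\sigma^f$, $\Sigma\to T$, and $S$-morphisms $f_i:X_i\to Y_i$ with $f_0\pi=\pi f_1$ and $f_0\sigma=\sigma^f f_1$; it is directly finite étale if $f_0,f_1$ are finite étale. We write $(X,\sigma)$ if $\Sigma=\{\sigma\}$. A Galois cover is a finite étale cover with connected source whose automorphism group acts transitively on geometric fibres. An almost direct Galois cover is a morphism $(Z,\Sigma)\to(X,T)$ such that $Z_i/X_i$ is a Galois cover with group $G_i$ ($i=0,1$); $G_0$ acts on $\Sigma$ by composition, with $T\simeq G_0\backslash\Sigma$; and there are homomorphisms $g\mapsto g^{\pi}$ and $g\mapsto g^{\sigma}$ ($\sigma\in\Sigma$)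 from $G_1$ to $G_0$ with $\pi g=g^{\pi}\pi$ and $\sigma g=g^\sigma\sigma$ for $g\in G_1$. The group $G_1$ acts on $\Sigma$ by conjugation, $\sigma\mapsto g^{\pi}\sigma g^{-1}=g^\pi(g^{-1})^\sigma\sigma$; a conjugacy domain is a subset $C\subseteq\Sigma$ stable under this action. Let $s$ be a prime of $R$ with $\varsigma^{-1}(s)=s$, and let $(F,\varphi)$ be an algebraically closed difference field extending the difference field $\kappa(s)$. A point of $(X,\Sigma)_s$ in $(F,\varphi)$ is a point $x_1\in X_1(F)$ above $\operatorname{Spec}F\to\operatorname{Spec}\kappa(s)\to S$ such that $\sigma x_1=(\pi x_1)\varphi$ for some $\sigma\in\Sigma$; put $x_0=\pi x_1$. For an almost direct Galois cover $(Z,\Sigma)\to(X,\sigma)$ and a point $x$ of $(X,\sigma)$, the local substitution $\varphi_x\subseteq\Sigma$ is the conjugacy class of any $\tau\in\Sigma$ with $\tau z_1=z_0\varphi$ for a point $z$ of $(Z,\Sigma)$ above $x$. For a conjugacy domain $C$, the Galois formula $\langle Z/X,C\rangle^\sharp$ assigns to $(s,(F,\varphi))$ the set of all $x_0$, where $x$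 runs through the points of $(X,\sigma)_s$ in $(F,\varphi)$ with $\varphi_x\subseteq C$. Let $f:(X,\sigma)\to(Y,\sigma)$ be directly finite étale with $Y_0,Y_1$ connected, let $p:(Z,\Sigma)\to(X,\sigma)$ be an almost direct Galois cover, and fix $\sigma_Z\in\Sigma$. A direct Galois closure of $Z$ over $Y$ is formed as follows. Let $\tilde Z_0\to Z_0$ be a Galois closure of $Z_0$ over $Y_0$. Let $\mathring Z_1$ be a connected component of $\tilde Z_0\times_{Z_0,\pi}Z_1\times_{\sigma_Z,Z_0}\tilde Z_0$, and let $\tilde Z_1$ be the connected component of $\tilde Z_0\times_{Y_0,\pi}Y_1\times_{\sigma,Y_0}\tilde Z_0$ into which it is mapped. Put $\mathring Z_0=\tilde Z_0$, let $\pi$ be the projection to the left factor $\tilde Z_0$, and let $\tilde\Sigma$ (resp. $\mathring\Sigma$) be the set of all $g\circ\mathrm{pr}$, with $\mathrm{pr}$ the projection to the right factor and $g\in\operatorname{Gal}(\tilde Z_0/Y_0)$ (resp. $g\in\operatorname{Gal}(\tilde Z_0/X_0)$). This gives morphisms $(\mathring Z,\mathring\Sigma)\to(Z,\Sigma)$,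 where $\mathring\Sigma\to\Sigma$ maps $g\circ\mathrm{pr}$ to $\bar g\sigma_Z$ with $\bar g\in\operatorname{Gal}(Z_0/X_0)$ induced by $g$, and $(\mathring Z,\mathring\Sigma)\to(\tilde Z,\tilde\Sigma)$, given on indices by the inclusion $\iota:\mathring\Sigma\hookrightarrow\tilde\Sigma$, $g\circ\mathrm{pr}\mapsto g\circ\mathrm{pr}$. Then $(\tilde Z,\tilde\Sigma)\to(Y,\sigma)$ is an almost direct Galois cover and, for every conjugacy domain $C\subseteq\Sigma$ with preimage $\mathring C\subseteq\mathring\Sigma$, $$f_\exists^\sharp\langle Z/X,C\rangle=\langle\tilde Z/Y,\iota_*\mathring C\rangle^\sharp,$$ where $\iota_*\mathring C$ is the least conjugacy domain in $\tilde\Sigma$ containing $\iota(\mathring C)$. That is, for all $s$ and all algebraically closed difference fields $(F,\varphi)$ extending $\kappa(s)$, the image under $f_0$ of $\langle Z/X,C\rangle^\sharp(s,(F,\varphi))$ is $\langle\tilde Z/Y,\iota_*\mathring C\rangle^\sharp(s,(F,\varphi))$. -/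

import Mathlib

open CategoryTheory CategoryTheory.Limits AlgebraicGeometry

universe u

namespace DirectPresentation

noncomputable section

/-! ### Finite étale morphisms: helper facts -/

theorem isReduced_of_finite_etale_ring (A B : Type u) [CommRing A] [CommRing B] [Algebra A B]
    [_root_.IsReduced A] [Module.Finite A B] [Algebra.Etale A B] : _root_.IsReduced B := by
  have hfp : Module.FinitePresentation A B :=
    Module.FinitePresentation.of_finite_of_finitePresentation A B
  have hflat : Module.Flat A B := inferInstance
  have : Module.Projective A B := Module.Flat.projective_of_finitePresentation
  refine ⟨fun b hb => ?_⟩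
  by_contra hne
  obtain ⟨l, hl⟩ : ∃ l : Module.Dual A B, l b ≠ 0 := by
    by_contra! h
    exact hne ((Module.forall_dual_apply_eq_zero_iff A b).mp h)
  obtain ⟨P, hP, hlP⟩ : ∃ P : Ideal A, P.IsPrime ∧ l b ∉ P := by
    by_contra! h
    apply hl
    have : l b ∈ nilradical A := by
      rw [nilradical_eq_sInf]
      exact Ideal.mem_sInf.mpr fun {I} hI => h I hI
    rwa [nilradical_eq_zero] at this
  have hr : _root_.IsReduced (TensorProduct A P.ResidueField B) :=
    Algebra.FormallyUnramified.isReduced_of_field P.ResidueField _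
  have h0 : TensorProduct.tmul A (1 : P.ResidueField) b = 0 := by
    have : IsNilpotent (TensorProduct.tmul A (1 : P.ResidueField) b) :=
      hb.map (Algebra.TensorProduct.includeRight : B →ₐ[A] TensorProduct A P.ResidueField B)
    exact this.eq_zero
  have h1 := congrArg (LinearMap.lTensor P.ResidueField l) h0
  rw [LinearMap.lTensor_tmul, map_zero] at h1
  have h2 := congrArg (TensorProduct.rid A P.ResidueField) h1
  rw [TensorProduct.rid_tmul, map_zero, Algebra.smul_def, mul_one] at h2
  exact hlP (Ideal.algebraMap_residueField_eq_zero.mp h2)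

theorem isReduced_of_finite_etale {X Y : Scheme.{u}} (f : X ⟶ Y) [IsFinite f] [Etale f]
    [IsReduced Y] : IsReduced X := by
  apply +allowSynthFailures @IsReduced.of_openCover (𝒰 := Y.affineCover.pullback₁ f)
  intro i
  let i : Y.affineCover.I₀ := i
  change IsReduced (pullback f (Y.affineCover.f i))
  have : IsReduced (Y.affineCover.X i) := isReduced_of_isOpenImmersion (Y.affineCover.f i)
  let g : pullback f (Y.affineCover.f i) ⟶ Y.affineCover.X i := pullback.snd _ _
  have : IsAffine (pullback f (Y.affineCover.f i)) := isAffine_of_isAffineHom g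
  have h1 : g.appTop.hom.Finite := g.finite_appTop
  have h2 : g.appTop.hom.Etale :=
    (HasRingHomProperty.iff_of_isAffine (P := @Etale)).mp inferInstance
  algebraize [g.appTop.hom]
  have := isReduced_of_finite_etale_ring Γ(Y.affineCover.X i, ⊤)
    Γ(pullback f (Y.affineCover.f i), ⊤)
  exact isReduced_of_isAffine_isReduced (X := pullback f (Y.affineCover.f i))

/-- Two morphisms from a connected scheme to a separated étale scheme agree as soon as they agree
at one field-valued point. -/
theorem hom_ext_of_point {T Z X : Scheme.{u}} (p : Z ⟶ X) [Etale p] [IsSeparated p]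
    [PreconnectedSpace T] (a b : T ⟶ Z) (h : a ≫ p = b ≫ p) {K : Type u} [Field K]
    (t : Spec (.of K) ⟶ T) (ht : t ≫ a = t ≫ b) : a = b := by
  obtain ⟨c, hc1, hc2⟩ : ∃ c : T ⟶ pullback p p,
      c ≫ pullback.fst p p = a ∧ c ≫ pullback.snd p p = b :=
    ⟨pullback.lift a b h, pullback.lift_fst _ _ _, pullback.lift_snd _ _ _⟩
  let e : pullback c (pullback.diagonal p) ⟶ T := pullback.fst _ _
  have : IsOpenImmersion e := inferInstance
  have : IsClosedImmersion e := inferInstance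
  have hcl : IsClopen (Set.range e) :=
    ⟨e.isClosedEmbedding.isClosed_range, e.isOpenEmbedding.isOpen_range⟩
  have hne : (Set.range e).Nonempty := by
    let t' : Spec (.of K) ⟶ pullback c (pullback.diagonal p) :=
      pullback.lift t (t ≫ a) (by
        apply pullback.hom_ext <;> simp [hc1, hc2, ht])
    exact ⟨_, ⟨t' (default : PrimeSpectrum K), rfl⟩⟩
  have hs : Set.range e = Set.univ := hcl.eq_univ hne
  have : Surjective e := ⟨Set.range_eq_univ.mp hs⟩
  have : IsIso e := IsOpenImmersion.isIso e
  have hc : e ≫ c = pullback.snd _ _ ≫ pullback.diagonal p := pullback.condition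
  have ha := congrArg (· ≫ pullback.fst p p) hc
  have hb := congrArg (· ≫ pullback.snd p p) hc
  simp only [Category.assoc, hc1, hc2, pullback.diagonal_fst, pullback.diagonal_snd] at ha hb
  exact (cancel_epi e).mp (ha.trans hb.symm)

/-! ### Varieties and almost direct presentations -/

/-- `s : X ⟶ S` is an algebraic variety over the affine scheme `S`: `X` is reduced, and separated
and of finite presentation over `S`. -/
structure IsVariety {X S : Scheme.{u}} (s : X ⟶ S) : Prop where
  isReduced : IsReduced X
  isSeparated : IsSeparated s
  locallyOfFinitePresentation : LocallyOfFinitePresentation s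
  quasiCompact : QuasiCompact s

theorem IsVariety.of_finite_etale {X Y S : Scheme.{u}} {s : Y ⟶ S} (hs : IsVariety s) (f : X ⟶ Y)
    [IsFinite f] [Etale f] : IsVariety (f ≫ s) := by
  obtain ⟨h1, h2, h3, h4⟩ := hs
  exact ⟨isReduced_of_finite_etale f, inferInstance, inferInstance, inferInstance⟩

end

end DirectPresentation

open DirectPresentation

/-- An object `(X, Σ)` of the category of almost direct presentations over the difference ring
`(R, ς)`: `X₀` and `X₁` are varieties over `S = Spec R`, `π : X₁ ⟶ X₀` is an `S`-morphism, and
every index `σ : Idx` (an element of `Σ`) gives a morphism `map σ : X₁ ⟶ X₀` which lies over the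
endomorphism `Spec ς` of `S`. -/
structure AlmostDirect {R : Type u} [CommRing R] (ς : R →+* R) where
  X₀ : Scheme.{u}
  X₁ : Scheme.{u}
  s₀ : X₀ ⟶ Spec (.of R)
  s₁ : X₁ ⟶ Spec (.of R)
  isVariety₀ : IsVariety s₀
  isVariety₁ : IsVariety s₁
  π : X₁ ⟶ X₀
  π_comp : π ≫ s₀ = s₁
  Idx : Type u
  map : Idx → (X₁ ⟶ X₀)
  map_comp : ∀ σ, map σ ≫ s₀ = s₁ ≫ Spec.map (CommRingCat.ofHom ς)

namespace AlmostDirect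

noncomputable section

variable {R : Type u} [CommRing R] {ς : R →+* R}

/-- Morphisms `(X, Σ) ⟶ (Y, T)` of almost direct presentations. -/
@[ext]
structure Hom (X Y : AlmostDirect ς) where
  idx : X.Idx → Y.Idx
  f₀ : X.X₀ ⟶ Y.X₀
  f₁ : X.X₁ ⟶ Y.X₁
  f₀_comp : f₀ ≫ Y.s₀ = X.s₀
  f₁_comp : f₁ ≫ Y.s₁ = X.s₁
  comm_π : X.π ≫ f₀ = f₁ ≫ Y.π
  comm_map : ∀ σ, X.map σ ≫ f₀ = f₁ ≫ Y.map (idx σ)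

instance : Category (AlmostDirect ς) where
  Hom := Hom
  id X := ⟨id, 𝟙 _, 𝟙 _, by simp, by simp, by simp, by simp⟩
  comp {X Y Z} f g :=
    { idx := g.idx ∘ f.idx
      f₀ := f.f₀ ≫ g.f₀
      f₁ := f.f₁ ≫ g.f₁
      f₀_comp := by rw [Category.assoc, g.f₀_comp, f.f₀_comp]
      f₁_comp := by rw [Category.assoc, g.f₁_comp, f.f₁_comp]
      comm_π := by rw [← Category.assoc, f.comm_π, Category.assoc, g.comm_π, Category.assoc]
      comm_map := fun σ => by
        rw [← Category.assoc, f.comm_map, Category.assoc, g.comm_map, Category.assoc]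
        rfl }
  id_comp _ := by apply Hom.ext <;> rfl
  comp_id _ := by apply Hom.ext <;> rfl
  assoc _ _ _ := by apply Hom.ext <;> rfl

variable {X Y Z : AlmostDirect ς}

@[simp] theorem comp_idx (f : X ⟶ Y) (g : Y ⟶ Z) (σ : X.Idx) :
    (f ≫ g).idx σ = g.idx (f.idx σ) := rfl

@[simp] theorem comp_f₀ (f : X ⟶ Y) (g : Y ⟶ Z) : (f ≫ g).f₀ = f.f₀ ≫ g.f₀ := rfl

@[simp] theorem comp_f₁ (f : X ⟶ Y) (g : Y ⟶ Z) : (f ≫ g).f₁ = f.f₁ ≫ g.f₁ := rfl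

/-- `f` is directly finite étale: `f₀` and `f₁` are finite étale (and so is then the base change
of `f₀` along `Spec ς`). -/
structure DirectlyFiniteEtale (f : X ⟶ Y) : Prop where
  isFinite₀ : IsFinite f.f₀
  etale₀ : Etale f.f₀
  isFinite₁ : IsFinite f.f₁
  etale₁ : Etale f.f₁

end

end AlmostDirect

namespace DirectPresentation

noncomputable section

variable {R : Type u} [CommRing R] {ς : R →+* R}

/-! ### Galois covers, Galois closures, connected components -/

/-- The group of automorphisms of `X` over `Y`. For `g h : Gal f` the product `g * h` acts as
"first `h`, then `g`". -/
abbrev Gal {X Y : Scheme.{u}} (f : X ⟶ Y) : Type u := Aut (Over.mk f)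

/-- The automorphism of the scheme `X` underlying `g`. -/
abbrev Gal.toHom {X Y : Scheme.{u}} {f : X ⟶ Y} (g : Gal f) : X ⟶ X := g.hom.left

theorem Gal.toHom_comp {X Y : Scheme.{u}} {f : X ⟶ Y} (g : Gal f) : g.toHom ≫ f = f :=
  Over.w g.hom

/-- `f : X ⟶ Y` is a (finite étale, connected) Galois cover, with group `Gal f`: the automorphism
group acts transitively on the geometric fibres. -/
structure IsGaloisCover {X Y : Scheme.{u}} (f : X ⟶ Y) : Prop where
  isFinite : IsFinite f
  etale : Etale f
  surjective : Surjective f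
  connected : ConnectedSpace X
  transitive : ∀ (K : Type u) [Field K] [IsAlgClosed K] (x x' : Spec (.of K) ⟶ X),
    x ≫ f = x' ≫ f → ∃ g : Gal f, x ≫ g.toHom = x'

/-- `q : T ⟶ X` is a Galois closure of `h : X ⟶ Y`: the composite `T ⟶ Y` is a Galois cover,
and every Galois cover of `Y` which dominates `X` dominates `T` over `X`. -/
structure IsGaloisClosure {T X Y : Scheme.{u}} (q : T ⟶ X) (h : X ⟶ Y) : Prop where
  isGaloisCover : IsGaloisCover (q ≫ h)
  minimal : ∀ {T' : Scheme.{u}} (q' : T' ⟶ X), IsGaloisCover (q' ≫ h) →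
    ∃ r : T' ⟶ T, r ≫ q = q'

/-- `j` is the inclusion of a connected component. -/
structure IsComponent {T W : Scheme.{u}} (j : T ⟶ W) : Prop where
  isOpenImmersion : IsOpenImmersion j
  range_eq : ∃ w : W, Set.range j = connectedComponent w

theorem IsComponent.isClosedImmersion {T W : Scheme.{u}} {j : T ⟶ W} (hj : IsComponent j) :
    IsClosedImmersion j := by
  have := hj.isOpenImmersion
  obtain ⟨w, hw⟩ := hj.range_eq
  refine IsClosedImmersion.of_isPreimmersion j ?_
  rw [hw]
  exact isClosed_connectedComponent

/-! ### Almost direct Galois covers -/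

/-- An almost direct Galois cover `p : (Z, Σ) ⟶ (X, T)` with group `G = (G₀, G₁)`, `Gᵢ` being the
Galois group of `Zᵢ` over `Xᵢ`. -/
structure AlmostDirectGaloisCover {Z X : AlmostDirect ς} (p : Z ⟶ X) where
  galois₀ : IsGaloisCover p.f₀
  galois₁ : IsGaloisCover p.f₁
  /-- The left action of `G₀` on `Σ`. -/
  act : Gal p.f₀ →* Equiv.Perm Z.Idx
  map_act : ∀ g σ, Z.map (act g σ) = Z.map σ ≫ g.toHom
  /-- `Σ → T` identifies `T` with the set of `G₀`-orbits. -/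
  idx_surjective : Function.Surjective p.idx
  idx_eq_iff : ∀ σ τ, p.idx σ = p.idx τ ↔ ∃ g, act g σ = τ
  /-- The homomorphism `g₁ ↦ g₁ ^ π`. -/
  piHom : Gal p.f₁ →* Gal p.f₀
  piHom_comm : ∀ g, g.toHom ≫ Z.π = Z.π ≫ (piHom g).toHom
  /-- The homomorphism `g₁ ↦ g₁ ^ σ`. -/
  mapHom : Z.Idx → (Gal p.f₁ →* Gal p.f₀)
  mapHom_comm : ∀ σ g, g.toHom ≫ Z.map σ = Z.map σ ≫ (mapHom σ g).toHom

namespace AlmostDirectGaloisCover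

variable {Z X : AlmostDirect ς} {p : Z ⟶ X} (hp : AlmostDirectGaloisCover p)

/-- Conjugation: `σ ^ g = g₀ σ g₁⁻¹ = g₀ (g₁⁻¹) ^ σ σ`, where `g = g₁` and `g₀ = g₁ ^ π`. -/
def conj (g : Gal p.f₁) (σ : Z.Idx) : Z.Idx :=
  hp.act (hp.piHom g * hp.mapHom σ g⁻¹) σ

/-- `C ⊆ Σ` is a conjugacy domain, i.e. a union of conjugacy classes. -/
def IsConjDomain (C : Set Z.Idx) : Prop :=
  ∀ σ ∈ C, ∀ g, hp.conj g σ ∈ C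

/-- The least conjugacy domain containing `B`. -/
def leastConjDomain (B : Set Z.Idx) : Set Z.Idx :=
  {σ | ∀ C, hp.IsConjDomain C → B ⊆ C → σ ∈ C}

end AlmostDirectGaloisCover

/-! ### Points over difference fields, Galois formulae -/

variable (ς) in
/-- A point `s` of `Spec^ς R`, i.e. a prime ideal with `ς⁻¹(s) = s`, together with an algebraically
closed difference field `(F, φ)` extending the difference field `(κ(s), ς^s)`. -/
structure Param where
  s : PrimeSpectrum R
  comap_s : s.asIdeal = s.asIdeal.comap ς
  F : Type u
  [field : Field F]
  [isAlgClosed : IsAlgClosed F]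
  φ : F →+* F
  j : s.asIdeal.ResidueField →+* F
  φ_comp_j : φ.comp j = j.comp (Ideal.ResidueField.map s.asIdeal s.asIdeal ς comap_s)

attribute [instance] Param.field Param.isAlgClosed

namespace Param

variable (P : Param ς)

/-- The scheme `Spec F`. -/
abbrev spec : Scheme.{u} := Spec (.of P.F)

/-- The structure morphism `Spec F ⟶ Spec κ(s) ⟶ Spec R`. -/
def toBase : P.spec ⟶ Spec (.of R) :=
  Spec.map (CommRingCat.ofHom (P.j.comp (algebraMap R P.s.asIdeal.ResidueField)))

/-- The endomorphism of `Spec F` given by `φ`. -/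
def phi : P.spec ⟶ P.spec := Spec.map (CommRingCat.ofHom P.φ)

end Param

/-- `σ x₁ = (π x₁) φ` for the `F`-valued point `x₁` of `X₁`. -/
def IsSubst (X : AlmostDirect ς) (P : Param ς) (x : P.spec ⟶ X.X₁) (σ : X.Idx) : Prop :=
  x ≫ X.map σ = P.phi ≫ x ≫ X.π

/-- The `(F, φ)`-points of the fibre `(X, Σ)_s`: the `F`-valued points `x₁` of `X₁` over
`Spec F ⟶ Spec R` with `σ x₁ = (π x₁) φ` for some `σ` in `Σ`. -/
def points (X : AlmostDirect ς) (P : Param ς) : Set (P.spec ⟶ X.X₁) :=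
  {x | x ≫ X.s₁ = P.toBase ∧ ∃ σ, IsSubst X P x σ}

/-- A family of sets of `F`-valued points of `X₀`. -/
abbrev Subassignment (X : AlmostDirect ς) := ∀ P : Param ς, Set (P.spec ⟶ X.X₀)

/-- Equivalence: equality over all algebraically closed difference fields. -/
def Equivalent {X : AlmostDirect ς} (A B : Subassignment X) : Prop := ∀ P, A P = B P

/-- The direct image `f_∃^♯ A`, i.e. the image of `A` under `f₀`. -/
def existsImage {X Y : AlmostDirect ς} (f : X ⟶ Y) (A : Subassignment X) : Subassignment Y :=
  fun P => (fun x => x ≫ f.f₀) '' A P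

namespace AlmostDirectGaloisCover

variable {Z X : AlmostDirect ς} {p : Z ⟶ X} (hp : AlmostDirectGaloisCover p)

/-- The local `φ`-substitution at the point `x` of `X`: the conjugacy class of the substitution
at a point `z` of `Z` lying above `x`. -/
def localSubst (P : Param ς) (x : P.spec ⟶ X.X₁) : Set Z.Idx :=
  {τ | ∃ z ∈ points Z P, z ≫ p.f₁ = x ∧ ∃ σ, IsSubst Z P z σ ∧ ∃ g, τ = hp.conj g σ}

/-- The point set `⟨Z/X, C⟩^♭`. -/
def formulaPoints (C : Set Z.Idx) (P : Param ς) : Set (P.spec ⟶ X.X₁) :=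
  {x | x ∈ points X P ∧ hp.localSubst P x ⊆ C}

/-- The Galois formula `⟨Z/X, C⟩^♯`, the projection of `⟨Z/X, C⟩^♭` along `π`. -/
def formula (C : Set Z.Idx) : Subassignment X :=
  fun P => (fun x => x ≫ X.π) '' hp.formulaPoints C P

end AlmostDirectGaloisCover

/-! ### The direct Galois closure -/

/-- The scheme `T ×_A B ×_A T`, formed with `q : T ⟶ A` on both sides, and with `a : B ⟶ A` on the
left and `b : B ⟶ A` on the right. -/
abbrev Corr {T A B : Scheme.{u}} (q : T ⟶ A) (a b : B ⟶ A) : Scheme.{u} :=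
  pullback (pullback.snd q a) (pullback.snd q b)

namespace Corr

variable {T A B : Scheme.{u}} (q : T ⟶ A) (a b : B ⟶ A)

def left : Corr q a b ⟶ T := pullback.fst _ _ ≫ pullback.fst q a

def mid : Corr q a b ⟶ B := pullback.fst _ _ ≫ pullback.snd q a

def right : Corr q a b ⟶ T := pullback.snd _ _ ≫ pullback.fst q b

theorem left_comp : left q a b ≫ q = mid q a b ≫ a := by
  rw [left, mid, Category.assoc, Category.assoc, pullback.condition]

theorem right_comp : right q a b ≫ q = mid q a b ≫ b := by
  have h : mid q a b = pullback.snd _ _ ≫ pullback.snd q b := pullback.condition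
  rw [h, right, Category.assoc, Category.assoc, pullback.condition]

instance [IsFinite q] : IsFinite (mid q a b) :=
  inferInstanceAs (IsFinite (pullback.fst (pullback.snd q a) (pullback.snd q b) ≫ pullback.snd q a))

instance [Etale q] : Etale (mid q a b) :=
  inferInstanceAs (Etale (pullback.fst (pullback.snd q a) (pullback.snd q b) ≫ pullback.snd q a))

variable {q a b} {V : Scheme.{u}} (l : V ⟶ T) (m : V ⟶ B) (r : V ⟶ T) (hl : l ≫ q = m ≫ a)
    (hr : r ≫ q = m ≫ b)

def lift : V ⟶ Corr q a b :=
  pullback.lift (pullback.lift l m hl) (pullback.lift r m hr)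
    ((pullback.lift_snd _ _ _).trans (pullback.lift_snd _ _ _).symm)

theorem lift_left : lift l m r hl hr ≫ left q a b = l := by
  rw [lift, left, pullback.lift_fst_assoc, pullback.lift_fst]

theorem lift_mid : lift l m r hl hr ≫ mid q a b = m := by
  rw [lift, mid, pullback.lift_fst_assoc, pullback.lift_snd]

theorem lift_right : lift l m r hl hr ≫ right q a b = r := by
  rw [lift, right, pullback.lift_snd_assoc, pullback.lift_fst]

end Corr

/-- The canonical morphism `T ×_{Z₀} Z₁ ×_{Z₀} T ⟶ T ×_{Y₀} Y₁ ×_{Y₀} T`. -/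
def corrMap {Z Y : AlmostDirect ς} (h : Z ⟶ Y) (σ : Z.Idx) {T : Scheme.{u}} (q : T ⟶ Z.X₀) :
    Corr q Z.π (Z.map σ) ⟶ Corr (q ≫ h.f₀) Y.π (Y.map (h.idx σ)) :=
  Corr.lift (Corr.left _ _ _) (Corr.mid _ _ _ ≫ h.f₁) (Corr.right _ _ _)
    (by rw [← Category.assoc, Corr.left_comp, Category.assoc, Category.assoc, h.comm_π])
    (by rw [← Category.assoc, Corr.right_comp, Category.assoc, Category.assoc, h.comm_map])

/-- The choices that make up a direct Galois closure of `h : (Z, σ) ⟶ (Y, σ)`: a Galois closure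
`T₀` of `Z₀` over `Y₀`, a connected component `O₁` of `T₀ ×_{Z₀} Z₁ ×_{Z₀} T₀` and the connected
component `T₁` of `T₀ ×_{Y₀} Y₁ ×_{Y₀} T₀` into which it is mapped. The fibre products are formed
with `π` on the left and `σ` on the right: a fibre product over `Z₀` along `σ` is the same as one
over the twist of `Z₀` by `ς`, with `T₀` replaced by its twist. -/
structure DirectGaloisClosure {Z Y : AlmostDirect ς} (h : Z ⟶ Y) (σ : Z.Idx) where
  T₀ : Scheme.{u}
  q : T₀ ⟶ Z.X₀
  isGaloisClosure : IsGaloisClosure q h.f₀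
  T₁ : Scheme.{u}
  j : T₁ ⟶ Corr (q ≫ h.f₀) Y.π (Y.map (h.idx σ))
  isComponent_j : IsComponent j
  O₁ : Scheme.{u}
  i : O₁ ⟶ Corr q Z.π (Z.map σ)
  isComponent_i : IsComponent i
  k : O₁ ⟶ T₁
  k_comp : k ≫ j = i ≫ corrMap h σ q

namespace DirectGaloisClosure

section

variable {Z Y : AlmostDirect ς} {h : Z ⟶ Y} {σ : Z.Idx} (D : DirectGaloisClosure h σ)

theorem comm_left : (D.j ≫ Corr.left _ _ _) ≫ D.q ≫ h.f₀ = (D.j ≫ Corr.mid _ _ _) ≫ Y.π := by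
  rw [Category.assoc, Corr.left_comp, Category.assoc]

theorem comm_right (g : Gal (D.q ≫ h.f₀)) :
    (D.j ≫ Corr.right _ _ _ ≫ g.toHom) ≫ D.q ≫ h.f₀ =
      (D.j ≫ Corr.mid _ _ _) ≫ Y.map (h.idx σ) := by
  rw [Category.assoc, Category.assoc, g.toHom_comp, Corr.right_comp, Category.assoc]

/-- `(Z̃, Σ̃)`, where `Σ̃` is the orbit under `Gal(T₀/Y₀)` of the projection of `T₁` to the right
factor `T₀`. -/
def tilde : AlmostDirect ς where
  X₀ := D.T₀
  X₁ := D.T₁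
  s₀ := (D.q ≫ h.f₀) ≫ Y.s₀
  s₁ := (D.j ≫ Corr.mid _ _ _) ≫ Y.s₁
  isVariety₀ := by
    have := D.isGaloisClosure.isGaloisCover.isFinite
    have := D.isGaloisClosure.isGaloisCover.etale
    exact Y.isVariety₀.of_finite_etale _
  isVariety₁ := by
    have := D.isGaloisClosure.isGaloisCover.isFinite
    have := D.isGaloisClosure.isGaloisCover.etale
    have := D.isComponent_j.isOpenImmersion
    have := D.isComponent_j.isClosedImmersion
    exact Y.isVariety₁.of_finite_etale _
  π := D.j ≫ Corr.left _ _ _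
  π_comp := by
    rw [← Category.assoc, D.comm_left, Category.assoc, Y.π_comp]
  Idx := Gal (D.q ≫ h.f₀)
  map g := D.j ≫ Corr.right _ _ _ ≫ g.toHom
  map_comp g := by
    rw [← Category.assoc, D.comm_right, Category.assoc, Y.map_comp, ← Category.assoc]

/-- `(Z̃, Σ̃) ⟶ (Y, σ)`. -/
def tildeToBase : D.tilde ⟶ Y where
  idx _ := h.idx σ
  f₀ := D.q ≫ h.f₀
  f₁ := D.j ≫ Corr.mid _ _ _
  f₀_comp := rfl
  f₁_comp := rfl
  comm_π := D.comm_left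
  comm_map := D.comm_right

end

section

variable {Z X Y : AlmostDirect ς} {p : Z ⟶ X} {f : X ⟶ Y} {σ : Z.Idx}
  (D : DirectGaloisClosure (p ≫ f) σ)

/-- The inclusion of `Gal(T₀/X₀)` into `Gal(T₀/Y₀)`. -/
def inclusion (g : Gal (D.q ≫ p.f₀)) : Gal (D.q ≫ (p ≫ f).f₀) where
  hom := Over.homMk g.hom.left (by
    have hg := Over.w g.hom
    simp only [Over.mk_left, Over.mk_hom] at hg
    change _ ≫ D.q ≫ p.f₀ ≫ f.f₀ = D.q ≫ p.f₀ ≫ f.f₀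
    rw [← Category.assoc D.q, ← Category.assoc g.hom.left, hg])
  inv := Over.homMk g.inv.left (by
    have hg := Over.w g.inv
    simp only [Over.mk_left, Over.mk_hom] at hg
    change _ ≫ D.q ≫ p.f₀ ≫ f.f₀ = D.q ≫ p.f₀ ≫ f.f₀
    rw [← Category.assoc D.q, ← Category.assoc g.inv.left, hg])
  hom_inv_id := by
    ext1
    exact congrArg (fun e => e.left) g.hom_inv_id
  inv_hom_id := by
    ext1
    exact congrArg (fun e => e.left) g.inv_hom_id

theorem inclusion_toHom (g : Gal (D.q ≫ p.f₀)) : (D.inclusion g).toHom = g.toHom := rfl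

theorem finite_etale_q (hp : AlmostDirectGaloisCover p)
    (hf : AlmostDirect.DirectlyFiniteEtale f) : IsFinite D.q ∧ Etale D.q := by
  have := hp.galois₀.isFinite
  have := hp.galois₀.etale
  have := hf.isFinite₀
  have := hf.etale₀
  have h1 : IsFinite (D.q ≫ p.f₀ ≫ f.f₀) := D.isGaloisClosure.isGaloisCover.isFinite
  have h2 : Etale (D.q ≫ p.f₀ ≫ f.f₀) := D.isGaloisClosure.isGaloisCover.etale
  exact ⟨IsFinite.of_comp D.q (p.f₀ ≫ f.f₀), Etale.of_comp D.q (p.f₀ ≫ f.f₀)⟩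

/-- Every automorphism of `T₀` over `X₀` induces one of `Z₀`. -/
theorem exists_restrict (hp : AlmostDirectGaloisCover p) (g : Gal (D.q ≫ p.f₀)) :
    ∃ g' : Gal p.f₀, g.toHom ≫ D.q = D.q ≫ g'.toHom := by
  have := hp.galois₀.isFinite
  have := hp.galois₀.etale
  have hc : ConnectedSpace D.T₀ := D.isGaloisClosure.isGaloisCover.connected
  obtain ⟨x⟩ := (inferInstance : Nonempty D.T₀)
  let K := AlgebraicClosure (D.T₀.residueField x)
  let t : Spec (.of K) ⟶ D.T₀ :=
    Spec.map (CommRingCat.ofHom (algebraMap (D.T₀.residueField x) K)) ≫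
      D.T₀.fromSpecResidueField x
  have hg : g.toHom ≫ D.q ≫ p.f₀ = D.q ≫ p.f₀ := g.toHom_comp
  obtain ⟨g', hg'⟩ := hp.galois₀.transitive K (t ≫ D.q) (t ≫ g.toHom ≫ D.q) (by
    simp only [Category.assoc, hg])
  refine ⟨g', hom_ext_of_point p.f₀ _ _ ?_ t ?_⟩
  · rw [Category.assoc, Category.assoc, hg, g'.toHom_comp]
  · rw [← hg', Category.assoc]

variable (hp : AlmostDirectGaloisCover p) (hf : AlmostDirect.DirectlyFiniteEtale f)

/-- The homomorphism `Gal(T₀/X₀) → Gal(Z₀/X₀)` (as a map). -/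
def restrict (g : Gal (D.q ≫ p.f₀)) : Gal p.f₀ := (D.exists_restrict hp g).choose

theorem restrict_comp (g : Gal (D.q ≫ p.f₀)) :
    g.toHom ≫ D.q = D.q ≫ (D.restrict hp g).toHom := (D.exists_restrict hp g).choose_spec

theorem comm_left_source :
    (D.i ≫ Corr.left _ _ _) ≫ D.q = (D.i ≫ Corr.mid _ _ _) ≫ Z.π := by
  rw [Category.assoc, Corr.left_comp, Category.assoc]

theorem comm_right_source (g : Gal (D.q ≫ p.f₀)) :
    (D.i ≫ Corr.right _ _ _ ≫ g.toHom) ≫ D.q =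
      (D.i ≫ Corr.mid _ _ _) ≫ Z.map (hp.act (D.restrict hp g) σ) := by
  have h1 := hp.map_act (D.restrict hp g) σ
  have h2 := D.restrict_comp hp g
  have h3 := Corr.right_comp D.q Z.π (Z.map σ)
  rw [Category.assoc, Category.assoc, h2, ← Category.assoc (Corr.right _ _ _), h3, h1]
  simp only [Category.assoc]

/-- `(Z̊, Σ̊)`, where `Σ̊` is the orbit under `Gal(T₀/X₀)` of the projection of `O₁` to the right
factor `T₀`. -/
def source : AlmostDirect ς where
  X₀ := D.T₀
  X₁ := D.O₁
  s₀ := D.q ≫ Z.s₀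
  s₁ := (D.i ≫ Corr.mid _ _ _) ≫ Z.s₁
  isVariety₀ := by
    obtain ⟨_, _⟩ := D.finite_etale_q hp hf
    exact Z.isVariety₀.of_finite_etale _
  isVariety₁ := by
    obtain ⟨_, _⟩ := D.finite_etale_q hp hf
    have := D.isComponent_i.isOpenImmersion
    have := D.isComponent_i.isClosedImmersion
    exact Z.isVariety₁.of_finite_etale _
  π := D.i ≫ Corr.left _ _ _
  π_comp := by
    rw [← Category.assoc, D.comm_left_source, Category.assoc, Z.π_comp]
  Idx := Gal (D.q ≫ p.f₀)
  map g := D.i ≫ Corr.right _ _ _ ≫ g.toHom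
  map_comp g := by
    rw [← Category.assoc, D.comm_right_source hp, Category.assoc, Z.map_comp, ← Category.assoc]

/-- `(Z̊, Σ̊) ⟶ (Z, Σ)`; on indices it is the surjection `Σ̊ → Σ`. -/
def sourceToCover : D.source hp hf ⟶ Z where
  idx g := hp.act (D.restrict hp g) σ
  f₀ := D.q
  f₁ := D.i ≫ Corr.mid _ _ _
  f₀_comp := rfl
  f₁_comp := rfl
  comm_π := D.comm_left_source
  comm_map := D.comm_right_source hp

theorem k_comp_left : D.k ≫ D.j ≫ Corr.left _ _ _ = D.i ≫ Corr.left _ _ _ := by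
  rw [← Category.assoc, D.k_comp, Category.assoc, corrMap, Corr.lift_left]

theorem k_comp_mid :
    D.k ≫ D.j ≫ Corr.mid _ _ _ = (D.i ≫ Corr.mid _ _ _) ≫ (p ≫ f).f₁ := by
  rw [← Category.assoc, D.k_comp, Category.assoc, corrMap, Corr.lift_mid, Category.assoc]

theorem k_comp_right : D.k ≫ D.j ≫ Corr.right _ _ _ = D.i ≫ Corr.right _ _ _ := by
  rw [← Category.assoc, D.k_comp, Category.assoc, corrMap, Corr.lift_right]

/-- `(Z̊, Σ̊) ⟶ (Z̃, Σ̃)`; on indices it is the inclusion `ι : Σ̊ → Σ̃`. -/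
def iota : D.source hp hf ⟶ D.tilde where
  idx := D.inclusion
  f₀ := 𝟙 D.T₀
  f₁ := D.k
  f₀_comp := by
    change 𝟙 D.T₀ ≫ (D.q ≫ p.f₀ ≫ f.f₀) ≫ Y.s₀ = D.q ≫ Z.s₀
    rw [Category.id_comp, Category.assoc, Category.assoc, f.f₀_comp, p.f₀_comp]
  f₁_comp := by
    change D.k ≫ (D.j ≫ Corr.mid _ _ _) ≫ Y.s₁ = (D.i ≫ Corr.mid _ _ _) ≫ Z.s₁
    rw [← Category.assoc, D.k_comp_mid, Category.assoc, (p ≫ f).f₁_comp]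
  comm_π := by
    change (D.i ≫ Corr.left _ _ _) ≫ 𝟙 D.T₀ = D.k ≫ D.j ≫ Corr.left _ _ _
    rw [Category.comp_id, D.k_comp_left]
  comm_map g := by
    change (D.i ≫ Corr.right _ _ _ ≫ g.toHom) ≫ 𝟙 D.T₀ = D.k ≫ D.j ≫ Corr.right _ _ _ ≫ g.toHom
    have h := D.k_comp_right
    rw [Category.comp_id, ← Category.assoc, ← h, Category.assoc, Category.assoc]

end

end DirectGaloisClosure

end

end DirectPresentation

namespace DirectPresentation

noncomputable section

/-! ### Field-valued points and finite étale morphisms -/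

/-! Everything rests on rigidity: morphisms from a connected scheme into a separated étale scheme
agree once they agree at one geometric point (`hom_ext_of_point`). A Galois group thus acts freely,
and also transitively, on the points of a fibre with values in any connected scheme
(`IsGaloisCover.gal_ext`, `IsGaloisCover.exists_gal`). This yields the homomorphisms from `G₁` to
`G₀`. It also makes a component of `T ×_A B ×_A T` Galois over `B`: pairs of automorphisms of `T`
act transitively on the geometric fibres, and a pair moving one point of the component into the
component preserves it.

In an almost direct Galois cover of some `(X, σ)`, each point `z` over a point `x` has exactly one
substitution, and changing `z` conjugates it. Membership of `x` in a Galois formula can therefore be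
tested at a single `z` (`mem_formulaPoints_iff`).

The two formulas are compared on `(Z̊, Σ̊)`. A point of `X` lifts to `Z` and then to `Z̊`, and its
image in `Z̃` has substitution in `ι(C̊)`. Conversely, a point of `Y` in the right-hand formula has
a lift to `Z̃` whose substitution, after conjugation, lies in `ι(C̊)`. This lift comes from `Z̊`,
because `O₁ → T₁` is finite étale and surjective and the degree-zero parts of `Z̊` and `Z̃`
coincide; its image in `X` is the required preimage. -/

theorem exists_geometricPoint (X : Scheme.{u}) [hX : Nonempty X] :
    ∃ (K : Type u) (_ : Field K) (_ : IsAlgClosed K), Nonempty (Spec (.of K) ⟶ X) := by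
  obtain ⟨x⟩ := hX
  exact ⟨AlgebraicClosure (X.residueField x), inferInstance, inferInstance,
    ⟨Spec.map (CommRingCat.ofHom (algebraMap (X.residueField x) _)) ≫ X.fromSpecResidueField x⟩⟩

/-- Points with values in an algebraically closed field lift along finite surjective morphisms. -/
theorem exists_lift_point {X Y : Scheme.{u}} (f : X ⟶ Y) [IsFinite f] [Surjective f]
    {K : Type u} [Field K] [IsAlgClosed K] (y : Spec (.of K) ⟶ Y) : ∃ x, x ≫ f = y := by
  let e : pullback f y ⟶ Spec (.of K) := pullback.snd f y
  have : IsAffine (pullback f y) := isAffine_of_isAffineHom e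
  obtain ⟨w₀, -⟩ := e.surjective (default : PrimeSpectrum K)
  have : Nonempty (pullback f y : Scheme.{u}) := ⟨w₀⟩
  -- The fibre is nonempty and finite over `K`; as `K` is algebraically closed, any closed point is
  -- `K`-rational.
  obtain ⟨w, -, hw⟩ := IsClosed.exists_closed_singleton
    (isClosed_univ (X := (pullback f y : Scheme.{u}))) Set.univ_nonempty
  refine ⟨pointOfClosedPoint e w hw ≫ pullback.fst f y, ?_⟩
  rw [Category.assoc, pullback.condition, pointOfClosedPoint_comp_assoc]

theorem surjective_of_finite_etale {X Y : Scheme.{u}} (f : X ⟶ Y) [IsFinite f] [Etale f]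
    [Nonempty X] [PreconnectedSpace Y] : Surjective f :=
  ⟨Set.range_eq_univ.mp (IsClopen.eq_univ
    ⟨f.isClosedMap.isClosed_range, f.isOpenMap.isOpen_range⟩ (Set.range_nonempty f))⟩

/-! ### Automorphisms of covers -/

namespace Gal

variable {X Y : Scheme.{u}} {f : X ⟶ Y}

theorem toHom_mul (g h : Gal f) : (g * h).toHom = h.toHom ≫ g.toHom := rfl

theorem toHom_one : (1 : Gal f).toHom = 𝟙 X := rfl

theorem toHom_comp_inv (g : Gal f) : g.toHom ≫ (g⁻¹).toHom = 𝟙 X := by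
  rw [← toHom_mul, inv_mul_cancel, toHom_one]

theorem toHom_inv_comp (g : Gal f) : (g⁻¹).toHom ≫ g.toHom = 𝟙 X := by
  rw [← toHom_mul, mul_inv_cancel, toHom_one]

theorem ext_toHom {g h : Gal f} (e : g.toHom = h.toHom) : g = h :=
  Aut.ext (Over.OverMorphism.ext e)

instance (g : Gal f) : IsIso g.toHom := ⟨_, g.toHom_comp_inv, g.toHom_inv_comp⟩

/-- The automorphism given by a pair of mutually inverse endomorphisms over the base. -/
def ofHom (a b : X ⟶ X) (ha : a ≫ f = f) (hb : b ≫ f = f) (hab : a ≫ b = 𝟙 X)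
    (hba : b ≫ a = 𝟙 X) : Gal f where
  hom := Over.homMk a ha
  inv := Over.homMk b hb
  hom_inv_id := Over.OverMorphism.ext hab
  inv_hom_id := Over.OverMorphism.ext hba

theorem ofHom_toHom (a b : X ⟶ X) (ha : a ≫ f = f) (hb : b ≫ f = f) (hab : a ≫ b = 𝟙 X)
    (hba : b ≫ a = 𝟙 X) : (ofHom a b ha hb hab hba).toHom = a := rfl

/-- Freeness of the action: a geometric point of `W` gives one point of `X` where the two
automorphisms agree, and rigidity does the rest. -/
theorem ext_of_comp [Etale f] [IsSeparated f] [PreconnectedSpace X] {W : Scheme.{u}} [Nonempty W]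
    (a : W ⟶ X) {g h : Gal f} (e : a ≫ g.toHom = a ≫ h.toHom) : g = h := by
  obtain ⟨K, _, _, ⟨t⟩⟩ := exists_geometricPoint W
  refine ext_toHom (hom_ext_of_point f _ _ (g.toHom_comp.trans h.toHom_comp.symm) (t ≫ a) ?_)
  rw [Category.assoc, e, Category.assoc]

end Gal

namespace IsGaloisCover

variable {X Y : Scheme.{u}} {f : X ⟶ Y}

theorem gal_ext (hf : IsGaloisCover f) {W : Scheme.{u}} [Nonempty W] (a : W ⟶ X) {g h : Gal f}
    (e : a ≫ g.toHom = a ≫ h.toHom) : g = h := by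
  have := hf.isFinite
  have := hf.etale
  have := hf.connected
  exact Gal.ext_of_comp a e

/-- The Galois group acts transitively on the points with values in a connected scheme. -/
theorem exists_gal (hf : IsGaloisCover f) {W : Scheme.{u}} [ConnectedSpace W] (a b : W ⟶ X)
    (h : a ≫ f = b ≫ f) : ∃ g : Gal f, a ≫ g.toHom = b := by
  have := hf.isFinite
  have := hf.etale
  obtain ⟨K, _, _, ⟨t⟩⟩ := exists_geometricPoint W
  obtain ⟨g, hg⟩ := hf.transitive K (t ≫ a) (t ≫ b) (by simp only [Category.assoc, h])
  refine ⟨g, hom_ext_of_point f _ _ ?_ t ?_⟩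
  · rw [Category.assoc, g.toHom_comp, h]
  · rw [← hg, Category.assoc]

variable {X' Y' : Scheme.{u}} {f' : X' ⟶ Y'}

/-- Both `a` and `g ≫ a` are `X`-valued points of `X'` over the same point of `Y'`. No base scheme
occurs, so this serves equally for `π` and for the `σ`, which lie over `Spec ς`. -/
theorem exists_induced (hf' : IsGaloisCover f') [ConnectedSpace X] (a : X ⟶ X')
    (b : Y ⟶ Y') (h : a ≫ f' = f ≫ b) (g : Gal f) :
    ∃ g' : Gal f', g.toHom ≫ a = a ≫ g'.toHom := by
  obtain ⟨g', hg'⟩ := hf'.exists_gal a (g.toHom ≫ a) (by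
    rw [Category.assoc, h, ← Category.assoc, g.toHom_comp])
  exact ⟨g', hg'.symm⟩

/-- The homomorphism of automorphism groups induced by a morphism of covers. -/
def inducedHom (hf' : IsGaloisCover f') [ConnectedSpace X] (a : X ⟶ X') (b : Y ⟶ Y')
    (h : a ≫ f' = f ≫ b) : Gal f →* Gal f' :=
  MonoidHom.mk' (fun g => (hf'.exists_induced a b h g).choose) (fun g k => by
    -- By freeness, an element of `Gal f'` is determined by its effect on `a`; hence the choices are
    -- multiplicative.
    refine hf'.gal_ext a ?_
    rw [← (hf'.exists_induced a b h (g * k)).choose_spec, Gal.toHom_mul, Gal.toHom_mul,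
      ← Category.assoc a, ← (hf'.exists_induced a b h k).choose_spec, Category.assoc,
      Category.assoc, ← (hf'.exists_induced a b h g).choose_spec])

theorem inducedHom_comm (hf' : IsGaloisCover f') [ConnectedSpace X] (a : X ⟶ X') (b : Y ⟶ Y')
    (h : a ≫ f' = f ≫ b) (g : Gal f) :
    g.toHom ≫ a = a ≫ (hf'.inducedHom a b h g).toHom :=
  (hf'.exists_induced a b h g).choose_spec

end IsGaloisCover

/-! ### Connected components -/

theorem IsComponent.connectedSpace {T W : Scheme.{u}} {j : T ⟶ W} (hj : IsComponent j) :
    ConnectedSpace T := by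
  have := hj.isOpenImmersion
  obtain ⟨w, hw⟩ := hj.range_eq
  have hc : _root_.IsConnected (Set.range j) := hw ▸ isConnected_connectedComponent
  rw [connectedSpace_iff_univ]
  refine ⟨?_, ?_⟩
  · obtain ⟨_, t, -⟩ := hc.nonempty
    exact ⟨t, trivial⟩
  · rw [← j.isOpenEmbedding.isInducing.isPreconnected_image, Set.image_univ]
    exact hc.isPreconnected

/-- A morphism from a connected scheme factors through a connected component as soon as one
field-valued point does. -/
theorem IsComponent.exists_lift {T W V : Scheme.{u}} {j : T ⟶ W} (hj : IsComponent j)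
    [ConnectedSpace V] (a : V ⟶ W) {K : Type u} [Field K] (t : Spec (.of K) ⟶ T)
    (v : Spec (.of K) ⟶ V) (h : v ≫ a = t ≫ j) : ∃ b : V ⟶ T, b ≫ j = a := by
  have := hj.isOpenImmersion
  refine ⟨IsOpenImmersion.lift j a ?_, IsOpenImmersion.lift_fac _ _ _⟩
  obtain ⟨w, hw⟩ := hj.range_eq
  let o : (Spec (.of K) : Scheme.{u}) := (default : PrimeSpectrum K)
  have hmem : a (v o) ∈ connectedComponent w := by
    rw [← hw]
    refine ⟨t o, ?_⟩
    rw [← Scheme.Hom.comp_apply, ← Scheme.Hom.comp_apply, h]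
  rw [hw, connectedComponent_eq hmem]
  exact (isPreconnected_range a.continuous).subset_connectedComponent ⟨_, rfl⟩

/-! ### Correspondences -/

namespace Corr

variable {T A B : Scheme.{u}} {q : T ⟶ A} {a b : B ⟶ A}

theorem hom_ext {V : Scheme.{u}} {c d : V ⟶ Corr q a b}
    (hl : c ≫ left q a b = d ≫ left q a b) (hm : c ≫ mid q a b = d ≫ mid q a b)
    (hr : c ≫ right q a b = d ≫ right q a b) : c = d := by
  have hm' : mid q a b = pullback.snd _ _ ≫ pullback.snd q b := pullback.condition
  refine pullback.hom_ext (pullback.hom_ext ?_ ?_) (pullback.hom_ext ?_ ?_)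
  · simpa only [left, Category.assoc] using hl
  · simpa only [mid, Category.assoc] using hm
  · simpa only [right, Category.assoc] using hr
  · simpa only [hm', Category.assoc] using hm

/-- The action of a pair of automorphisms of `T` on `T ×_A B ×_A T`. -/
def actHom (g k : Gal q) : Corr q a b ⟶ Corr q a b :=
  lift (left q a b ≫ g.toHom) (mid q a b) (right q a b ≫ k.toHom)
    (by rw [Category.assoc, g.toHom_comp, left_comp])
    (by rw [Category.assoc, k.toHom_comp, right_comp])

theorem actHom_left (g k : Gal q) : actHom g k ≫ left q a b = left q a b ≫ g.toHom :=
  lift_left _ _ _ _ _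

theorem actHom_mid (g k : Gal q) : actHom g k ≫ mid q a b = mid q a b := lift_mid _ _ _ _ _

theorem actHom_right (g k : Gal q) : actHom g k ≫ right q a b = right q a b ≫ k.toHom :=
  lift_right _ _ _ _ _

theorem actHom_comp (g k g' k' : Gal q) :
    actHom g k ≫ actHom g' k' = (actHom (g' * g) (k' * k) : Corr q a b ⟶ _) := by
  refine hom_ext ?_ ?_ ?_
  · rw [Category.assoc, actHom_left, ← Category.assoc, actHom_left, actHom_left, Category.assoc,
      Gal.toHom_mul]
  · rw [Category.assoc, actHom_mid, actHom_mid, actHom_mid]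
  · rw [Category.assoc, actHom_right, ← Category.assoc, actHom_right, actHom_right,
      Category.assoc, Gal.toHom_mul]

theorem actHom_one : actHom (1 : Gal q) 1 = 𝟙 (Corr q a b) := by
  refine hom_ext ?_ ?_ ?_
  · rw [actHom_left, Gal.toHom_one, Category.comp_id, Category.id_comp]
  · rw [actHom_mid, Category.id_comp]
  · rw [actHom_right, Gal.toHom_one, Category.comp_id, Category.id_comp]

end Corr

/-- A connected component of `T ×_A B ×_A T` is a Galois cover of `B` if `T` is one of `A`. -/
theorem IsComponent.isGaloisCover_mid {T A B T₁ : Scheme.{u}} {q : T ⟶ A} {a b : B ⟶ A}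
    {j : T₁ ⟶ Corr q a b} (hj : IsComponent j) (hq : IsGaloisCover q) [PreconnectedSpace B] :
    IsGaloisCover (j ≫ Corr.mid q a b) := by
  have := hq.isFinite
  have := hq.etale
  have := hj.isOpenImmersion
  have := hj.isClosedImmersion
  have := hj.connectedSpace
  refine ⟨inferInstance, inferInstance, surjective_of_finite_etale _, inferInstance, ?_⟩
  intro K _ _ x x' hx
  -- The left projections of `x` and `x'` have the same image in `A`, and so do the right ones; this
  -- provides one automorphism of `T` for each factor.
  obtain ⟨g, hg⟩ := hq.transitive K (x ≫ j ≫ Corr.left q a b) (x' ≫ j ≫ Corr.left q a b) (by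
    simp only [Category.assoc, Corr.left_comp]
    simpa only [Category.assoc] using congrArg (· ≫ a) hx)
  obtain ⟨k, hk⟩ := hq.transitive K (x ≫ j ≫ Corr.right q a b) (x' ≫ j ≫ Corr.right q a b) (by
    simp only [Category.assoc, Corr.right_comp]
    simpa only [Category.assoc] using congrArg (· ≫ b) hx)
  have hxx' : x ≫ j ≫ Corr.actHom g k = x' ≫ j := by
    refine Corr.hom_ext ?_ ?_ ?_
    · simpa only [Category.assoc, Corr.actHom_left] using hg
    · simpa only [Category.assoc, Corr.actHom_mid] using hx
    · simpa only [Category.assoc, Corr.actHom_right] using hk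
  have hx'x : x' ≫ j ≫ Corr.actHom g⁻¹ k⁻¹ = x ≫ j := by
    rw [← Category.assoc, ← hxx', Category.assoc, Category.assoc, Corr.actHom_comp,
      inv_mul_cancel, inv_mul_cancel, Corr.actHom_one, Category.comp_id]
  -- The pair `(g, k)` sends one point of `T₁` into `T₁`, hence preserves this component; so does
  -- the inverse pair, which gives the inverse automorphism.
  obtain ⟨c, hc⟩ := hj.exists_lift (j ≫ Corr.actHom g k) x' x hxx'
  obtain ⟨d, hd⟩ := hj.exists_lift (j ≫ Corr.actHom g⁻¹ k⁻¹) x x' hx'x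
  have hcd : c ≫ d = 𝟙 T₁ := by
    rw [← cancel_mono j, Category.assoc, hd, ← Category.assoc, hc, Category.assoc,
      Corr.actHom_comp, inv_mul_cancel, inv_mul_cancel, Corr.actHom_one, Category.comp_id,
      Category.id_comp]
  have hdc : d ≫ c = 𝟙 T₁ := by
    rw [← cancel_mono j, Category.assoc, hc, ← Category.assoc, hd, Category.assoc,
      Corr.actHom_comp, mul_inv_cancel, mul_inv_cancel, Corr.actHom_one, Category.comp_id,
      Category.id_comp]
  refine ⟨Gal.ofHom c d ?_ ?_ hcd hdc, ?_⟩
  · rw [← Category.assoc, hc, Category.assoc, Corr.actHom_mid]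
  · rw [← Category.assoc, hd, Category.assoc, Corr.actHom_mid]
  · rw [← cancel_mono j, Gal.ofHom_toHom, Category.assoc, hc, hxx']

variable {R : Type u} [CommRing R] {ς : R →+* R}

/-- A direct Galois closure is an almost direct Galois cover of the base. -/
def DirectGaloisClosure.tildeCover {Z Y : AlmostDirect ς} [Unique Y.Idx] [PreconnectedSpace Y.X₁]
    {h : Z ⟶ Y} {σ : Z.Idx} (D : DirectGaloisClosure h σ) :
    AlmostDirectGaloisCover D.tildeToBase :=
  have : ConnectedSpace D.tilde.X₁ := D.isComponent_j.connectedSpace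
  have hG : IsGaloisCover D.tildeToBase.f₀ := D.isGaloisClosure.isGaloisCover
  { galois₀ := hG
    galois₁ := D.isComponent_j.isGaloisCover_mid D.isGaloisClosure.isGaloisCover
    -- The index set is the group itself with left translation: a single orbit, matching the single
    -- index of `Y`.
    act := MulAction.toPermHom (Gal (D.q ≫ h.f₀)) (Gal (D.q ≫ h.f₀))
    map_act := fun (g τ : Gal (D.q ≫ h.f₀)) =>
      show D.j ≫ Corr.right _ _ _ ≫ τ.toHom ≫ g.toHom =
        (D.j ≫ Corr.right _ _ _ ≫ τ.toHom) ≫ g.toHom by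
      rw [Category.assoc, Category.assoc]
    idx_surjective := fun t => ⟨(1 : Gal (D.q ≫ h.f₀)), Subsingleton.elim _ _⟩
    idx_eq_iff := fun τ τ' => iff_of_true (Subsingleton.elim _ _)
      (MulAction.exists_smul_eq (Gal (D.q ≫ h.f₀)) (α := Gal (D.q ≫ h.f₀)) τ τ')
    piHom := hG.inducedHom D.tilde.π Y.π D.tildeToBase.comm_π
    piHom_comm := hG.inducedHom_comm D.tilde.π Y.π D.tildeToBase.comm_π
    mapHom := fun τ => hG.inducedHom (D.tilde.map τ) (Y.map _) (D.tildeToBase.comm_map τ)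
    mapHom_comm := fun τ =>
      hG.inducedHom_comm (D.tilde.map τ) (Y.map _) (D.tildeToBase.comm_map τ) }

/-! ### Conjugation and substitutions in almost direct Galois covers -/

theorem IsSubst.map {X Y : AlmostDirect ς} {P : Param ς} {x : P.spec ⟶ X.X₁} {σ : X.Idx}
    (hx : IsSubst X P x σ) (f : X ⟶ Y) : IsSubst Y P (x ≫ f.f₁) (f.idx σ) := by
  unfold IsSubst at hx ⊢
  rw [Category.assoc, ← f.comm_map, ← Category.assoc, hx]
  simp only [Category.assoc, f.comm_π]

instance (P : Param ς) : Nonempty P.spec := inferInstanceAs (Nonempty (PrimeSpectrum P.F))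

namespace AlmostDirectGaloisCover

variable {Z X : AlmostDirect ς} {p : Z ⟶ X} (hp : AlmostDirectGaloisCover p)

/-- Since `gτk = g k^τ τ = (g k^τ g⁻¹) gτ`, freeness identifies the two elements. This is what makes
conjugation a group action in `conj_mul`. -/
theorem mapHom_act (g : Gal p.f₀) (τ : Z.Idx) (k : Gal p.f₁) :
    hp.mapHom (hp.act g τ) k = g * hp.mapHom τ k * g⁻¹ := by
  have := hp.galois₁.connected
  refine hp.galois₀.gal_ext (Z.map (hp.act g τ)) ?_
  rw [← hp.mapHom_comm, hp.map_act, Gal.toHom_mul, Gal.toHom_mul, ← Category.assoc,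
    hp.mapHom_comm]
  simp only [Category.assoc]
  rw [← Category.assoc g.toHom, Gal.toHom_comp_inv, Category.id_comp]

theorem conj_one (τ : Z.Idx) : hp.conj 1 τ = τ := by
  simp [conj]

theorem conj_mul (g k : Gal p.f₁) (τ : Z.Idx) : hp.conj (g * k) τ = hp.conj g (hp.conj k τ) := by
  unfold conj
  rw [hp.mapHom_act, ← Equiv.Perm.mul_apply, ← map_mul]
  simp only [map_mul, map_inv, mul_inv_rev]
  group

theorem isConjDomain_orbit (B : Set Z.Idx) :
    hp.IsConjDomain {τ | ∃ b ∈ B, ∃ g, τ = hp.conj g b} := by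
  rintro _ ⟨b, hb, g, rfl⟩ k
  exact ⟨b, hb, k * g, (hp.conj_mul k g b).symm⟩

theorem isConjDomain_leastConjDomain (B : Set Z.Idx) : hp.IsConjDomain (hp.leastConjDomain B) :=
  fun τ hτ g C hC hB => hC τ (hτ C hC hB) g

theorem exists_conj_of_mem_leastConjDomain {B : Set Z.Idx} {τ : Z.Idx}
    (hτ : τ ∈ hp.leastConjDomain B) : ∃ b ∈ B, ∃ g, τ = hp.conj g b :=
  hτ _ (hp.isConjDomain_orbit B) fun b hb => ⟨b, hb, 1, (hp.conj_one b).symm⟩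

/-- With `σ ^ g = g^π σ g⁻¹`, one has `σ ^ g (g z) = g^π σ z = g^π (π z) φ = π (g z) φ`. -/
theorem isSubst_conj {P : Param ς} {z : P.spec ⟶ Z.X₁} {τ : Z.Idx} (hz : IsSubst Z P z τ)
    (g : Gal p.f₁) : IsSubst Z P (z ≫ g.toHom) (hp.conj g τ) := by
  unfold IsSubst at hz ⊢
  rw [conj, hp.map_act, Gal.toHom_mul, Category.assoc, ← Category.assoc g.toHom,
    hp.mapHom_comm, Category.assoc, ← Category.assoc (hp.mapHom τ g).toHom, map_inv,
    Gal.toHom_comp_inv, Category.id_comp, Category.assoc, hp.piHom_comm, ← Category.assoc, hz]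
  simp only [Category.assoc]

/-- Two indices over the same index of `X` differ by some `g` in `G₀`. Here `g` fixes the point `τ
z`, so it is trivial. -/
theorem isSubst_unique (hp : AlmostDirectGaloisCover p) [Subsingleton X.Idx] {P : Param ς} {z : P.spec ⟶ Z.X₁} {τ τ' : Z.Idx}
    (hτ : IsSubst Z P z τ) (hτ' : IsSubst Z P z τ') : τ = τ' := by
  obtain ⟨g, rfl⟩ := (hp.idx_eq_iff τ τ').mp (Subsingleton.elim _ _)
  have hg : g = 1 := by
    refine hp.galois₀.gal_ext (z ≫ Z.map τ) ?_
    rw [Gal.toHom_one, Category.comp_id, Category.assoc, ← hp.map_act]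
    exact hτ'.trans hτ.symm
  rw [hg, map_one, Equiv.Perm.one_apply]

/-- Any other point above `x` is a `G₁`-translate of `z`, so its substitution is a conjugate of `τ`,
and `C` is stable under conjugation. -/
theorem mem_formulaPoints_iff [Subsingleton X.Idx] {C : Set Z.Idx} (hC : hp.IsConjDomain C)
    {P : Param ς} {z : P.spec ⟶ Z.X₁} {τ : Z.Idx} (hs : z ≫ Z.s₁ = P.toBase)
    (hz : IsSubst Z P z τ) : z ≫ p.f₁ ∈ hp.formulaPoints C P ↔ τ ∈ C := by
  refine ⟨fun h => h.2 ⟨z, ⟨hs, τ, hz⟩, rfl, τ, hz, 1, (hp.conj_one τ).symm⟩, fun hτ =>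
    ⟨⟨?_, _, hz.map p⟩, ?_⟩⟩
  · rw [Category.assoc, p.f₁_comp, hs]
  · rintro _ ⟨z', -, hzz', τ', hz', g, rfl⟩
    obtain ⟨k, hk⟩ := hp.galois₁.transitive P.F z z' hzz'.symm
    have h := hp.isSubst_conj hz k
    rw [hk] at h
    rw [hp.isSubst_unique hz' h]
    exact hC _ (hC _ hτ k) g

/-- For any lift `z` and any `τ` over the index of `x`, the points `τ z` and `(π z) φ` agree in
`X₀`. An element of `G₀` carries one to the other and corrects `τ`. -/
theorem exists_isSubst_above (hp : AlmostDirectGaloisCover p) {P : Param ς} {x : P.spec ⟶ X.X₁} (hx : x ∈ points X P) :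
    ∃ (z : P.spec ⟶ Z.X₁) (τ : Z.Idx), z ≫ p.f₁ = x ∧ z ≫ Z.s₁ = P.toBase ∧ IsSubst Z P z τ := by
  have := hp.galois₁.isFinite
  have := hp.galois₁.surjective
  obtain ⟨hs, t, ht⟩ := hx
  obtain ⟨z, rfl⟩ := exists_lift_point p.f₁ x
  obtain ⟨τ, rfl⟩ := hp.idx_surjective t
  unfold IsSubst at ht
  obtain ⟨g, hg⟩ := hp.galois₀.transitive P.F (z ≫ Z.map τ) (P.phi ≫ z ≫ Z.π) (by
    simp only [Category.assoc, p.comm_map, p.comm_π]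
    simpa only [Category.assoc] using ht)
  refine ⟨z, hp.act g τ, rfl, ?_, ?_⟩
  · rw [← p.f₁_comp, ← Category.assoc, hs]
  · rw [IsSubst, hp.map_act, ← hg, Category.assoc]

end AlmostDirectGaloisCover

/-! ### Points of the direct Galois closure and the direct image -/

namespace DirectGaloisClosure

variable {Z X Y : AlmostDirect ς} {p : Z ⟶ X} {f : X ⟶ Y} {σ : Z.Idx}
  (D : DirectGaloisClosure (p ≫ f) σ)

/-- Two points of `T₀` with the same image in `X₀` are conjugate under `Gal(T₀/X₀)`. -/
theorem exists_gal_subcover (hf : AlmostDirect.DirectlyFiniteEtale f) {W : Scheme.{u}}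
    [ConnectedSpace W] (a b : W ⟶ D.T₀) (h : a ≫ D.q ≫ p.f₀ = b ≫ D.q ≫ p.f₀) :
    ∃ g : Gal (D.q ≫ p.f₀), a ≫ g.toHom = b := by
  have := hf.isFinite₀
  have := hf.etale₀
  have := D.isGaloisClosure.isGaloisCover.connected
  obtain ⟨g, hg⟩ := D.isGaloisClosure.isGaloisCover.exists_gal a b (by
    simp only [AlmostDirect.comp_f₀]
    simpa only [Category.assoc] using congrArg (· ≫ f.f₀) h)
  obtain ⟨K, _, _, ⟨t⟩⟩ := exists_geometricPoint W
  -- An automorphism over `Y₀` is one over `X₀` as soon as this holds at one point, by rigidity for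
  -- the finite étale `X₀ → Y₀`.
  have hover : ∀ k : Gal (D.q ≫ (p ≫ f).f₀), a ≫ k.toHom ≫ D.q ≫ p.f₀ = a ≫ D.q ≫ p.f₀ →
      k.toHom ≫ D.q ≫ p.f₀ = D.q ≫ p.f₀ := by
    intro k hk
    refine hom_ext_of_point f.f₀ _ _ ?_ (t ≫ a) ?_
    · simpa only [AlmostDirect.comp_f₀, Category.assoc] using k.toHom_comp
    · rw [Category.assoc, hk, Category.assoc]
  have hg1 : g.toHom ≫ D.q ≫ p.f₀ = D.q ≫ p.f₀ := hover g (by rw [← Category.assoc, hg, h])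
  have hg2 : (g⁻¹).toHom ≫ D.q ≫ p.f₀ = D.q ≫ p.f₀ := by
    conv_lhs => rw [← hg1]
    rw [← Category.assoc, Gal.toHom_inv_comp, Category.id_comp]
  exact ⟨Gal.ofHom g.toHom (g⁻¹).toHom hg1 hg2 g.toHom_comp_inv g.toHom_inv_comp, hg⟩

variable (hp : AlmostDirectGaloisCover p) (hf : AlmostDirect.DirectlyFiniteEtale f)

/-- Points of `Z₁` lift to `O₁`; a lift of a point of `(Z, Σ)` is a point of `(Z̊, Σ̊)`. -/
theorem exists_source_above_cover [Subsingleton X.Idx] {P : Param ς} {z : P.spec ⟶ Z.X₁}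
    {τ : Z.Idx} (hs : z ≫ Z.s₁ = P.toBase) (hz : IsSubst Z P z τ) :
    ∃ (o : P.spec ⟶ (D.source hp hf).X₁) (g : (D.source hp hf).Idx),
      o ≫ (D.sourceToCover hp hf).f₁ = z ∧ o ≫ (D.source hp hf).s₁ = P.toBase ∧
        IsSubst (D.source hp hf) P o g := by
  obtain ⟨_, _⟩ := D.finite_etale_q hp hf
  have := D.isComponent_i.isOpenImmersion
  have := D.isComponent_i.isClosedImmersion
  have := D.isComponent_i.connectedSpace
  have := hp.galois₁.connected
  have : Surjective (D.i ≫ Corr.mid D.q Z.π (Z.map σ)) := surjective_of_finite_etale _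
  obtain ⟨o, rfl⟩ := exists_lift_point (D.i ≫ Corr.mid D.q Z.π (Z.map σ)) z
  obtain ⟨a, rfl⟩ := (hp.idx_eq_iff σ τ).mp (Subsingleton.elim _ _)
  -- The right projection of `o` and the `φ`-twist of its left projection need only agree in `X₀`;
  -- passing to `X₀` turns `aσ` into `σ`.
  obtain ⟨g, hg⟩ := D.exists_gal_subcover hf (o ≫ D.i ≫ Corr.right D.q Z.π (Z.map σ))
    (P.phi ≫ o ≫ D.i ≫ Corr.left D.q Z.π (Z.map σ)) (by
      rw [IsSubst, hp.map_act] at hz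
      have h := congrArg (· ≫ p.f₀) hz
      simp only [Category.assoc, a.toHom_comp] at h
      simp only [Category.assoc]
      rw [← Category.assoc (Corr.right _ _ _), Corr.right_comp,
        ← Category.assoc (Corr.left _ _ _), Corr.left_comp]
      simpa only [Category.assoc] using h)
  refine ⟨o, g, rfl, ?_, ?_⟩
  · rw [← hs, Category.assoc]
    rfl
  · change o ≫ D.i ≫ Corr.right _ _ _ ≫ g.toHom = P.phi ≫ o ≫ D.i ≫ Corr.left _ _ _
    simpa only [Category.assoc] using hg

/-- Points of `(Z̃, Σ̃)` with substitution in `Σ̊` lift to points of `(Z̊, Σ̊)`. -/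
theorem exists_source_above_tilde {P : Param ς} {z : P.spec ⟶ D.tilde.X₁}
    {g : (D.source hp hf).Idx} (hs : z ≫ D.tilde.s₁ = P.toBase)
    (hz : IsSubst D.tilde P z ((D.iota hp hf).idx g)) :
    ∃ o : P.spec ⟶ (D.source hp hf).X₁, o ≫ (D.iota hp hf).f₁ = z ∧
      o ≫ (D.source hp hf).s₁ = P.toBase ∧ IsSubst (D.source hp hf) P o g := by
  obtain ⟨_, _⟩ := D.finite_etale_q hp hf
  have := D.isComponent_i.isOpenImmersion
  have := D.isComponent_i.isClosedImmersion
  have := D.isComponent_j.isOpenImmersion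
  have := D.isComponent_j.isClosedImmersion
  have := D.isComponent_i.connectedSpace
  have := D.isComponent_j.connectedSpace
  have := hp.galois₁.isFinite
  have := hp.galois₁.etale
  have := hf.isFinite₁
  have := hf.etale₁
  have := D.isGaloisClosure.isGaloisCover.isFinite
  have := D.isGaloisClosure.isGaloisCover.etale
  let m := D.j ≫ Corr.mid (D.q ≫ (p ≫ f).f₀) Y.π (Y.map ((p ≫ f).idx σ))
  -- Both `m` and `k ≫ m` are finite étale, hence so is `k`; its image is then all of the connected
  -- `T₁`.
  have hkm : D.k ≫ m = (D.i ≫ Corr.mid D.q Z.π (Z.map σ)) ≫ p.f₁ ≫ f.f₁ := D.k_comp_mid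
  have : IsFinite (D.k ≫ m) := by rw [hkm]; infer_instance
  have : Etale (D.k ≫ m) := by rw [hkm]; infer_instance
  have : IsFinite (D.iota hp hf).f₁ := IsFinite.of_comp D.k m
  have : Etale (D.iota hp hf).f₁ := Etale.of_comp D.k m
  have : Nonempty (D.source hp hf).X₁ := inferInstanceAs (Nonempty D.O₁)
  have : PreconnectedSpace D.tilde.X₁ := inferInstanceAs (PreconnectedSpace D.T₁)
  have : Surjective (D.iota hp hf).f₁ := surjective_of_finite_etale _
  have : IsIso (D.iota hp hf).f₀ := inferInstanceAs (IsIso (𝟙 D.T₀))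
  obtain ⟨o, rfl⟩ := exists_lift_point (D.iota hp hf).f₁ z
  refine ⟨o, rfl, ?_, ?_⟩
  · rw [← hs, ← (D.iota hp hf).f₁_comp, Category.assoc]
  · unfold IsSubst at hz ⊢
    -- The map on `T₀` is the identity, so the equation for a substitution holds upstairs once it
    -- holds in `Z̃`.
    rw [← cancel_mono (D.iota hp hf).f₀]
    simpa only [Category.assoc, (D.iota hp hf).comm_map, (D.iota hp hf).comm_π] using hz

theorem f₁_square : (D.sourceToCover hp hf).f₁ ≫ p.f₁ ≫ f.f₁ =
    (D.iota hp hf).f₁ ≫ D.tildeToBase.f₁ := D.k_comp_mid.symm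

/-- The point sets underlying the direct image of a Galois formula. -/
theorem image_formulaPoints [Subsingleton X.Idx] [Unique Y.Idx] [PreconnectedSpace Y.X₁]
    {C : Set Z.Idx} (hC : hp.IsConjDomain C) (P : Param ς) :
    (fun x => x ≫ f.f₁) '' hp.formulaPoints C P = D.tildeCover.formulaPoints
      (D.tildeCover.leastConjDomain
        ((D.iota hp hf).idx '' ((D.sourceToCover hp hf).idx ⁻¹' C))) P := by
  have hC' := D.tildeCover.isConjDomain_leastConjDomain
    ((D.iota hp hf).idx '' ((D.sourceToCover hp hf).idx ⁻¹' C))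
  ext y
  constructor
  · rintro ⟨x, hx, rfl⟩
    obtain ⟨z, τ, rfl, hs, hz⟩ := hp.exists_isSubst_above hx.1
    obtain ⟨o, g, rfl, hos, ho⟩ := D.exists_source_above_cover hp hf hs hz
    have hg : (D.sourceToCover hp hf).idx g ∈ C :=
      (hp.mem_formulaPoints_iff hC hs (ho.map (D.sourceToCover hp hf))).mp hx
    have e : ((o ≫ (D.sourceToCover hp hf).f₁) ≫ p.f₁) ≫ f.f₁ =
        (o ≫ (D.iota hp hf).f₁) ≫ D.tildeToBase.f₁ := by
      rw [Category.assoc, Category.assoc, D.f₁_square, Category.assoc]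
    change ((o ≫ (D.sourceToCover hp hf).f₁) ≫ p.f₁) ≫ f.f₁ ∈ _
    rw [e]
    refine (D.tildeCover.mem_formulaPoints_iff hC' ?_ (ho.map (D.iota hp hf))).mpr ?_
    · rw [Category.assoc, (D.iota hp hf).f₁_comp, hos]
    · exact fun _ _ hB => hB ⟨g, hg, rfl⟩
  · intro hy
    obtain ⟨z, τ, rfl, hs, hz⟩ := D.tildeCover.exists_isSubst_above hy.1
    obtain ⟨_, ⟨b, hb, rfl⟩, g, rfl⟩ := D.tildeCover.exists_conj_of_mem_leastConjDomain
      ((D.tildeCover.mem_formulaPoints_iff hC' hs hz).mp hy)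
    -- Translating `z` by `g⁻¹` stays above the same point of `Y₁` and makes the substitution
    -- exactly `ι(b)`.
    have hz' := D.tildeCover.isSubst_conj hz g⁻¹
    rw [← D.tildeCover.conj_mul, inv_mul_cancel, D.tildeCover.conj_one] at hz'
    obtain ⟨o, ho, hos, hob⟩ := D.exists_source_above_tilde hp hf (by
      rw [← D.tildeToBase.f₁_comp, Category.assoc, ← Category.assoc (Gal.toHom _),
        Gal.toHom_comp, D.tildeToBase.f₁_comp, hs]) hz'
    refine ⟨(o ≫ (D.sourceToCover hp hf).f₁) ≫ p.f₁,
      (hp.mem_formulaPoints_iff hC ?_ (hob.map (D.sourceToCover hp hf))).mpr hb, ?_⟩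
    · rw [Category.assoc, (D.sourceToCover hp hf).f₁_comp, hos]
    · change ((o ≫ (D.sourceToCover hp hf).f₁) ≫ p.f₁) ≫ f.f₁ = _
      rw [Category.assoc, Category.assoc, D.f₁_square, ← Category.assoc, ho, Category.assoc,
        Gal.toHom_comp]

end DirectGaloisClosure

end

end DirectPresentation

theorem mainTheorem8 {R : Type u} [CommRing R] [IsDomain R] (ς : R →+* R)
    (hς : Function.Injective ς) {Z X Y : AlmostDirect ς} [Unique X.Idx] [Unique Y.Idx]
    [ConnectedSpace Y.X₀] [ConnectedSpace Y.X₁]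
    (f : X ⟶ Y) (hf : AlmostDirect.DirectlyFiniteEtale f)
    (p : Z ⟶ X) (hp : AlmostDirectGaloisCover p)
    (σ : Z.Idx) (D : DirectGaloisClosure (p ≫ f) σ) :
    ∃ hq : AlmostDirectGaloisCover D.tildeToBase,
      ∀ C : Set Z.Idx, hp.IsConjDomain C →
        Equivalent (existsImage f (hp.formula C))
          (hq.formula (hq.leastConjDomain
            ((D.iota hp hf).idx '' ((D.sourceToCover hp hf).idx ⁻¹' C)))) := by
  refine ⟨D.tildeCover, fun C hC P => ?_⟩
  unfold existsImage AlmostDirectGaloisCover.formula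
  -- The identity already holds for points of `Y₁`; projecting along `π` and using `f₀ π = π f₁`
  -- gives it for the formulas.
  rw [← D.image_formulaPoints hp hf hC P, Set.image_image, Set.image_image]
  simp only [Category.assoc, f.comm_π]
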